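/- Let $B=(B_t)_{t\ge 0}$ be a real standard Brownian motion on a probability space, let $\sigma\in(0,\infty)$, and let $\mu:(0,\infty)\to(0,\infty)$ be continuous and strictly decreasing with $\lim_{a\to0^+}\mu(a)=\infty$. Put $X_t(0)=0$ and $X_t(a)=\sigma B_t-\mu(a)t$ for $a\in(0,\infty)$, $t\ge 0$. Let $w$ be a finite initial condition, that is, a stochastic process $w:[0,\infty)\to[0,\infty)$ independent of $B$, with continuous nondecreasing paths, $w(0)=0$, $\mathbb{E}\big[\int_0^1 w(a)a^{-2}\,da\big]<\infty$ and $\mathbb{E}[w(\infty)]<\infty$, where $w(\infty)=\lim_{a\to\infty}w(a)$. For $a,t\ge0$ let $\chi_t(a)=w(a)+X_t(a)$ and let $$W_t^w(a)=\chi_t(a)-\Big(\inf_{0\le s\le t}\chi_s(a)\Big)\wedge 0$$ be the reflecting coupled Brownian motions with initial condition $w$. Then $$\mathbb{P}\Big(\forall\,T\ge0\ \ \exists\,t\ge T:\ \sup_{a\in[0,\infty)}W_t^w(a)=0\Big)=1 .$$ Suppose in addition that $\int_0^\infty \frac{1}{a^2\mu(a)}\,da<\infty$, and let $\mathcal{Z}_t^w$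 be the measure on $[0,\infty)$ determined, path by path, by $$\mathcal{Z}_t^w(\{0\})=0,\qquad \mathcal{Z}_t^w([0,a])=\int_0^a\frac{W_t^w(x)}{x^2}\,dx+\frac{W_t^w(a)}{a}\quad(0<a<\infty),\qquad \mathcal{Z}_t^w([0,\infty))=\int_0^\infty\frac{W_t^w(x)}{x^2}\,dx .$$ Then $$\mathbb{P}\big(\forall\,T\ge0\ \ \exists\,t\ge T:\ \mathcal{Z}_t^w=\mathbf{0}\big)=1,$$ where $\mathbf{0}$ is the zero measure. -/

import Mathlib

open MeasureTheory ProbabilityTheory Set Filter Topology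
open scoped NNReal ENNReal

namespace CoupledBM

/-- `μ : (0,∞) → (0,∞)` is a drift function: strictly decreasing, continuous, and exploding at `0`.
Its value at `0` plays no role. -/
structure IsDriftFunction (μ : ℝ≥0 → ℝ) : Prop where
  pos : ∀ a, 0 < a → 0 < μ a
  strictAnti : StrictAntiOn μ (Ioi 0)
  cont : ContinuousOn μ (Ioi 0)
  tendsto_zero : Tendsto μ (𝓝[>] 0) atTop

/-- The integrability assumption `∫₀^∞ 1 / (a² μ(a)) da < ∞`. -/
def IntegrableDrift (μ : ℝ≥0 → ℝ) : Prop :=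
  ∫⁻ a in Ioi (0 : ℝ), ENNReal.ofReal (1 / (a ^ 2 * μ a.toNNReal)) < ∞

section Paths

variable {Ω : Type*} [MeasurableSpace Ω]

/-- `w` is a finite initial condition relative to the driving process `B`: a process
`w : [0,∞) → [0,∞)`, independent of `B`, with continuous nondecreasing paths and `w(0) = 0` almost
surely, such that `E[∫₀¹ w(a)/a² da] < ∞` and `E[w(∞)] < ∞`.
For nondecreasing paths `w(∞) = lim_{a → ∞} w(a)` is the supremum in `[0,∞]`. -/
structure IsFiniteInitialCondition (B : ℝ≥0 → Ω → ℝ) (w : ℝ≥0 → Ω → ℝ≥0) (P : Measure Ω) :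
    Prop where
  aemeasurable : ∀ a, AEMeasurable (w a) P
  indep : IndepFun (fun ω a => w a ω) (fun ω t => B t ω) P
  cont : ∀ᵐ ω ∂P, Continuous (fun a => w a ω)
  mono : ∀ᵐ ω ∂P, Monotone (fun a => w a ω)
  zero : ∀ᵐ ω ∂P, w 0 ω = 0
  integral_near_zero :
    ∫⁻ ω, (∫⁻ a in Ioc (0 : ℝ) 1, ENNReal.ofReal ((w a.toNNReal ω : ℝ) / a ^ 2)) ∂P < ∞
  integral_at_infty : ∫⁻ ω, (⨆ a : ℝ≥0, (w a ω : ℝ≥0∞)) ∂P < ∞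

/-- Coupled Brownian motions started from zero: `X_t(0) = 0` and `X_t(a) = σ B_t - μ(a) t` for
`a > 0`. -/
noncomputable def cbm (σ : ℝ) (μ : ℝ≥0 → ℝ) (B : ℝ≥0 → Ω → ℝ) (t a : ℝ≥0) (ω : Ω) : ℝ :=
  if a = 0 then 0 else σ * B t ω - μ a * t

/-- The one-dimensional Skorokhod map `Ψ[f](t) = f(t) - (inf_{0 ≤ s ≤ t} f(s)) ∧ 0`. -/
noncomputable def skorokhodMap (f : ℝ≥0 → ℝ) (t : ℝ≥0) : ℝ :=
  f t - min (sInf (f '' Icc 0 t)) 0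

/-- Reflecting coupled Brownian motions with initial condition `w`:
`W_t(a) = Ψ[χ(a)](t)`, where `χ_t(a) = w(a) + X_t(a)`. -/
noncomputable def rcbm (σ : ℝ) (μ : ℝ≥0 → ℝ) (B : ℝ≥0 → Ω → ℝ) (w : ℝ≥0 → Ω → ℝ≥0)
    (t a : ℝ≥0) (ω : Ω) : ℝ :=
  skorokhodMap (fun s => (w a ω : ℝ) + cbm σ μ B s a ω) t

end Paths

/-- The equations linking a measure `ζ` on `[0,∞)` to a function `f` on `[0,∞)`: `ζ` has no mass
at `0`, `ζ([0,a]) = ∫₀^a f(x)/x² dx + f(a)/a` for `0 < a < ∞`, and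
`ζ([0,∞)) = ∫₀^∞ f(x)/x² dx`. -/
structure MassEquations (f : ℝ≥0 → ℝ) (ζ : Measure ℝ≥0) : Prop where
  zero : ζ {0} = 0
  Icc : ∀ a : ℝ≥0, 0 < a → ζ (Icc 0 a) =
    (∫⁻ x in Ioc (0 : ℝ) a, ENNReal.ofReal (f x.toNNReal / x ^ 2)) + ENNReal.ofReal (f a / a)
  univ : ζ univ = ∫⁻ x in Ioi (0 : ℝ), ENNReal.ofReal (f x.toNNReal / x ^ 2)

open Classical in
/-- The finite measure on `[0,∞)` determined by the mass equations of `f` (see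
`massMeasure_spec` and `massMeasure_unique`). If no finite measure satisfies them, the value is the
infinite measure `⊤`, which is not the zero measure. -/
noncomputable def massMeasure (f : ℝ≥0 → ℝ) : Measure ℝ≥0 :=
  if h : ∃ ζ : Measure ℝ≥0, IsFiniteMeasure ζ ∧ MassEquations f ζ then h.choose else ⊤

/-- A finite measure is determined by the mass equations. -/
theorem massMeasure_unique {f : ℝ≥0 → ℝ} {ζ : Measure ℝ≥0} [IsFiniteMeasure ζ]
    (h : MassEquations f ζ) : massMeasure f = ζ := by
  have hex : ∃ ζ : Measure ℝ≥0, IsFiniteMeasure ζ ∧ MassEquations f ζ := ⟨ζ, ‹_›, h⟩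
  have hdef : massMeasure f = hex.choose := by rw [massMeasure, dif_pos hex]
  rw [hdef]
  obtain ⟨h1, h2⟩ := hex.choose_spec
  refine Measure.ext_of_Iic _ _ fun a => ?_
  have hI : Iic a = Set.Icc 0 a := by ext; simp
  rw [hI]
  rcases eq_or_ne a 0 with rfl | ha
  · rw [Icc_self, h2.zero, h.zero]
  · rw [h2.Icc a (pos_iff_ne_zero.2 ha), h.Icc a (pos_iff_ne_zero.2 ha)]

theorem lintegral_Ici_inv_sq {x : ℝ} (hx : 0 < x) :
    ∫⁻ y in Ici x, ENNReal.ofReal (1 / y ^ 2) = ENNReal.ofReal (1 / x) := by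
  rw [setLIntegral_congr Ioi_ae_eq_Ici.symm]
  have hcongr : ∀ y ∈ Ioi x, y ^ (-2 : ℝ) = 1 / y ^ 2 := fun y hy => by
    have hy0 : 0 < y := hx.trans hy
    rw [Real.rpow_neg hy0.le]; norm_num
  have hi := (integrableOn_Ioi_rpow_of_lt (a := -2) (by norm_num) hx).congr_fun hcongr
    measurableSet_Ioi
  rw [← ofReal_integral_eq_lintegral_ofReal hi (ae_of_all _ fun y => by positivity),
    ← setIntegral_congr_fun measurableSet_Ioi hcongr, integral_Ioi_rpow_of_lt (by norm_num) hx]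
  congr 1
  have : (-2 : ℝ) + 1 = -1 := by norm_num
  rw [this, Real.rpow_neg_one]; field_simp

/-- The mass equations have a finite solution for every continuous nondecreasing `f` with
`f(0) = 0` and `∫₀^∞ f(x)/x² dx < ∞`. -/
theorem massMeasure_spec {f : ℝ≥0 → ℝ} (hc : Continuous f) (hm : Monotone f) (h0 : f 0 = 0)
    (hf : ∫⁻ x in Ioi (0 : ℝ), ENNReal.ofReal (f x.toNNReal / x ^ 2) < ∞) :
    IsFiniteMeasure (massMeasure f) ∧ MassEquations f (massMeasure f) := by
  let G : StieltjesFunction ℝ≥0 := ⟨f, hm, fun x => hc.continuousWithinAt⟩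
  have hG : ∀ b, G.measure (Ioc 0 b) = ENNReal.ofReal (f b) := fun b => by
    rw [G.measure_Ioc]; change ENNReal.ofReal (f b - f 0) = _; rw [h0, sub_zero]
  have hG0 : G.measure {0} = 0 := by
    rw [← botSet_eq_singleton_of_isBot (x := (0 : ℝ≥0)) (fun _ => zero_le)]
    exact G.measure_botSet
  let k : ℝ≥0 → ℝ≥0∞ := fun x => ENNReal.ofReal (1 / (x : ℝ))
  have hk : Measurable k := by fun_prop
  let ζ : Measure ℝ≥0 := G.measure.withDensity k
  -- Tonelli's theorem
  have key : ∀ S : Set ℝ, MeasurableSet S →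
      ∫⁻ x in Ioi (0 : ℝ≥0), (∫⁻ y in Ici (x : ℝ) ∩ S, ENNReal.ofReal (1 / y ^ 2)) ∂G.measure
        = ∫⁻ y in Ioi 0 ∩ S, ENNReal.ofReal (f y.toNNReal / y ^ 2) := by
    intro S hS
    let F : ℝ≥0 → ℝ → ℝ≥0∞ := fun x y =>
      {p : ℝ≥0 × ℝ | 0 < p.1 ∧ (p.1 : ℝ) ≤ p.2 ∧ p.2 ∈ S}.indicator
        (fun p => ENNReal.ofReal (1 / p.2 ^ 2)) (x, y)
    have hset : MeasurableSet {p : ℝ≥0 × ℝ | 0 < p.1 ∧ (p.1 : ℝ) ≤ p.2 ∧ p.2 ∈ S} := by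
      refine (measurableSet_lt measurable_const measurable_fst).inter
        ((measurableSet_le (by fun_prop) measurable_snd).inter (measurable_snd hS))
    have hF : Measurable (Function.uncurry F) := by
      change Measurable (Set.indicator _ _)
      exact Measurable.indicator (by fun_prop) hset
    have hL : ∫⁻ x in Ioi (0 : ℝ≥0), (∫⁻ y in Ici (x : ℝ) ∩ S, ENNReal.ofReal (1 / y ^ 2)) ∂G.measure
        = ∫⁻ x, (∫⁻ y, F x y) ∂G.measure := by
      rw [← lintegral_indicator measurableSet_Ioi]
      refine lintegral_congr fun x => ?_
      by_cases hx : x ∈ Ioi (0 : ℝ≥0)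
      · rw [indicator_of_mem hx, ← lintegral_indicator (measurableSet_Ici.inter hS)]
        refine lintegral_congr fun y => ?_
        have hx' : 0 < x := hx
        by_cases hxy : (x : ℝ) ≤ y <;> by_cases hyS : y ∈ S <;>
          simp [F, indicator, hx', hxy, hyS]
      · rw [indicator_of_notMem hx]
        have hx' : ¬ 0 < x := hx
        simp [F, indicator, hx']
    have hR : ∫⁻ y in Ioi 0 ∩ S, ENNReal.ofReal (f y.toNNReal / y ^ 2)
        = ∫⁻ y, (∫⁻ x, F x y ∂G.measure) := by
      rw [← lintegral_indicator (measurableSet_Ioi.inter hS)]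
      refine lintegral_congr fun y => ?_
      have hFy : ∀ x, F x y = (Ioc (0 : ℝ≥0) y.toNNReal).indicator
          (fun _ => (Ioi 0 ∩ S).indicator (fun y => ENNReal.ofReal (1 / y ^ 2)) y) x := by
        intro x
        by_cases hx : 0 < x
        · by_cases hy : 0 < y
          · have : x ≤ y.toNNReal ↔ (x : ℝ) ≤ y := Real.le_toNNReal_iff_coe_le hy.le
            by_cases hxy : (x : ℝ) ≤ y <;> by_cases hyS : y ∈ S <;>
              simp [F, indicator, hx, hy, this, hxy, hyS]
          · have h1 : ¬ (x : ℝ) ≤ y := fun h => hy (lt_of_lt_of_le (by exact_mod_cast hx) h)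
            simp [F, indicator, hy, h1]
        · simp [F, indicator, hx]
      simp only [hFy]
      rw [lintegral_indicator_const measurableSet_Ioc, hG]
      by_cases hy : y ∈ Ioi 0 ∩ S
      · rw [indicator_of_mem hy, indicator_of_mem hy, ← ENNReal.ofReal_mul (by positivity)]
        congr 1; ring
      · rw [indicator_of_notMem hy, indicator_of_notMem hy, zero_mul]
    rw [hL, hR, lintegral_lintegral_swap hF.aemeasurable]
  have hzero : ζ {0} = 0 := withDensity_absolutelyContinuous _ _ hG0
  have huniv : ζ univ = ∫⁻ x in Ioi (0 : ℝ), ENNReal.ofReal (f x.toNNReal / x ^ 2) := by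
    have hdisj : univ = {0} ∪ Ioi (0 : ℝ≥0) := by
      ext x; simp
    have h1 : ζ univ = ζ (Ioi 0) := by
      refine le_antisymm ?_ (measure_mono (subset_univ _))
      rw [hdisj]
      exact (measure_union_le _ _).trans (by rw [hzero, zero_add])
    rw [h1, withDensity_apply _ measurableSet_Ioi]
    have := key univ MeasurableSet.univ
    simp only [inter_univ] at this
    rw [← this]
    refine setLIntegral_congr_fun measurableSet_Ioi fun x hx => ?_
    exact (lintegral_Ici_inv_sq (by exact_mod_cast hx)).symm
  have hIcc : ∀ a : ℝ≥0, 0 < a → ζ (Set.Icc 0 a) =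
      (∫⁻ x in Ioc (0 : ℝ) a, ENNReal.ofReal (f x.toNNReal / x ^ 2))
        + ENNReal.ofReal (f a / a) := by
    intro a ha
    have ha' : (0 : ℝ) < a := by exact_mod_cast ha
    have hdisj : Set.Icc 0 a = {0} ∪ Ioc (0 : ℝ≥0) a := by
      ext x
      rcases eq_or_ne x 0 with rfl | hx
      · simp
      · simp
    have h1 : ζ (Set.Icc 0 a) = ζ (Ioc 0 a) := by
      refine le_antisymm ?_ (measure_mono Ioc_subset_Icc_self)
      rw [hdisj]
      exact (measure_union_le _ _).trans (by rw [hzero, zero_add])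
    rw [h1, withDensity_apply _ measurableSet_Ioc]
    have hS := key (Iio (a : ℝ)) measurableSet_Iio
    rw [← setLIntegral_congr (Ioo_ae_eq_Ioc (a := (0 : ℝ)) (b := (a : ℝ)))]
    have hIoo : Ioo (0 : ℝ) a = Ioi 0 ∩ Iio (a : ℝ) := rfl
    rw [hIoo, ← hS]
    have hsplit : ∀ x ∈ Ioc (0 : ℝ≥0) a, k x =
        (∫⁻ y in Ici (x : ℝ) ∩ Iio (a : ℝ), ENNReal.ofReal (1 / y ^ 2))
          + ENNReal.ofReal (1 / (a : ℝ)) := by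
      intro x hx
      have hx0 : (0 : ℝ) < x := by exact_mod_cast hx.1
      have hxa : (x : ℝ) ≤ a := by exact_mod_cast hx.2
      change ENNReal.ofReal (1 / (x : ℝ)) = _
      rw [← lintegral_Ici_inv_sq hx0, ← lintegral_Ici_inv_sq ha',
        ← lintegral_union measurableSet_Ici]
      · congr 2
        ext y
        simp only [mem_Ici, mem_union, mem_inter_iff, mem_Iio]
        constructor
        · intro h
          rcases lt_or_ge y a with h' | h'
          · exact Or.inl ⟨h, h'⟩
          · exact Or.inr h'
        · rintro (h | h)
          · exact h.1
          · exact hxa.trans h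
      · exact Set.disjoint_left.2 fun y hy hy' => (not_lt.2 (mem_Ici.1 hy')) hy.2
    rw [setLIntegral_congr_fun measurableSet_Ioc hsplit, lintegral_add_right _ measurable_const,
      setLIntegral_const, hG, ← ENNReal.ofReal_mul (by positivity)]
    congr 1
    · rw [← Ioc_union_Ioi_eq_Ioi ha.le, lintegral_union measurableSet_Ioi
        (Set.disjoint_left.2 fun y hy hy' => (not_lt.2 hy.2) hy')]
      have h0 : ∫⁻ x in Ioi a, (∫⁻ y in Ici (x : ℝ) ∩ Iio (a : ℝ), ENNReal.ofReal (1 / y ^ 2))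
          ∂G.measure = ∫⁻ _ in Ioi a, 0 ∂G.measure := by
        refine setLIntegral_congr_fun measurableSet_Ioi fun x hxa => ?_
        have : Ici (x : ℝ) ∩ Iio (a : ℝ) = ∅ := by
          ext y
          simp only [mem_inter_iff, mem_Ici, mem_Iio, mem_empty_iff_false, iff_false, not_and, not_lt]
          intro h
          exact le_trans (by exact_mod_cast (mem_Ioi.1 hxa).le) h
        rw [this]; simp
      rw [h0, lintegral_zero, add_zero]
    · congr 1; ring
  have hfin : IsFiniteMeasure ζ := ⟨by rw [huniv]; exact hf⟩
  have hζ : MassEquations f ζ := ⟨hzero, hIcc, huniv⟩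
  rw [massMeasure_unique hζ]
  exact ⟨hfin, hζ⟩

/-- The measure-valued process `𝒵_t` of the reflecting coupled Brownian motions: the measure
determined by the mass equations of `a ↦ W_t(a)`, path by path. -/
noncomputable def rcbmMeasure {Ω : Type*} [MeasurableSpace Ω] (σ : ℝ) (μ : ℝ≥0 → ℝ)
    (B : ℝ≥0 → Ω → ℝ) (w : ℝ≥0 → Ω → ℝ≥0) (t : ℝ≥0) (ω : Ω) : Measure ℝ≥0 :=
  massMeasure (fun a => rcbm σ μ B w t a ω)

end CoupledBM

/-! All coordinates share one noise and every drift pushes down. If `B` is at a running minimum at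
time `t`, then so is `σ B_s - μ(a) s` for every `a > 0`. If moreover `σ B_t ≤ -C`, where `C` bounds
the path of `w`, then each `χ_t(a)` is a nonpositive running minimum, and the reflection puts every
`W_t(a)` at zero at once (`rcbm_eq_zero`).

So two almost sure facts suffice: `w` is bounded, since its supremum has finite mean, and `B` is
unbounded below (`ae_exists_lt`), which by continuity yields record minima as late and as low as
desired. For the second claim, the zero function has the zero measure as its mass measure. -/

/-! ### Unboundedness below of Brownian paths -/

/-- Second Borel-Cantelli lemma for independent random variables hitting sets whose probabilities
are all equal to the same positive number. -/
theorem ProbabilityTheory.iIndepFun.ae_frequently_mem {Ω : Type*} [MeasurableSpace Ω]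
    {P : Measure Ω} [IsProbabilityMeasure P] {X : ℕ → Ω → ℝ} (hX : iIndepFun X P)
    (hm : ∀ k, AEMeasurable (X k) P) {S : ℕ → Set ℝ} (hS : ∀ k, MeasurableSet (S k))
    {p : ℝ≥0∞} (hp : p ≠ 0) (hXS : ∀ k, P.map (X k) (S k) = p) :
    ∀ᵐ ω ∂P, ∃ᶠ k in atTop, X k ω ∈ S k := by
  -- Borel–Cantelli is applied to measurable events, so the variables are replaced by measurable
  -- versions, which stay independent.
  let Y : ℕ → Ω → ℝ := fun k => (hm k).mk (X k)
  have hYm : ∀ k, Measurable (Y k) := fun k => (hm k).measurable_mk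
  have hYX : ∀ k, X k =ᵐ[P] Y k := fun k => (hm k).ae_eq_mk
  have hY : iIndepFun Y P := hX.congr hYX
  have hE : ∀ k, MeasurableSet (Y k ⁻¹' S k) := fun k => hYm k (hS k)
  have hind : iIndepSet (fun k => Y k ⁻¹' S k) P := by
    rw [iIndepSet_iff_meas_biInter hE]
    exact fun s => hY.measure_inter_preimage_eq_mul s fun i _ => hS i
  have hsum : ∑' k, P (Y k ⁻¹' S k) = ∞ := by
    have h : ∀ k, P (Y k ⁻¹' S k) = p := fun k => by
      rw [← Measure.map_apply (hYm k) (hS k), ← Measure.map_congr (hYX k), hXS]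
    simp only [h]
    exact ENNReal.tsum_const_eq_top_of_ne_zero hp
  have h1 := measure_limsup_eq_one hE hind hsum
  have h2 : ∀ᵐ ω ∂P, ω ∈ limsup (fun k => Y k ⁻¹' S k) atTop :=
    (mem_ae_iff_prob_eq_one (MeasurableSet.measurableSet_limsup hE)).2 h1
  filter_upwards [h2, ae_all_iff.2 hYX] with ω hω hω'
  rw [mem_limsup_iff_frequently_mem] at hω
  exact hω.mono fun k hk => by rw [hω' k]; exact hk

/-- By scaling, falling by at least one standard deviation has the same probability for every
variance, so these probabilities do not decay along a sequence of increments. -/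
theorem ProbabilityTheory.gaussianReal_Iic_neg_sqrt {v : ℝ≥0} (hv : v ≠ 0) :
    gaussianReal 0 v (Iic (-√(v : ℝ))) = gaussianReal 0 1 (Iic (-1)) := by
  have hs : 0 < √(v : ℝ) := Real.sqrt_pos.2 (by exact_mod_cast pos_iff_ne_zero.2 hv)
  have hmap : gaussianReal 0 v = (gaussianReal 0 1).map (√(v : ℝ) * ·) := by
    rw [gaussianReal_map_const_mul]
    congr 1
    · simp
    · ext; simp
  rw [hmap, Measure.map_apply (by fun_prop) measurableSet_Iic]
  congr 1
  ext x
  simp only [mem_preimage, mem_Iic]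
  constructor <;> intro h <;> nlinarith

/-- Lebesgue measure is absolutely continuous with respect to the Gaussian, and a half-line is not
Lebesgue null. -/
theorem ProbabilityTheory.gaussianReal_Iic_pos (x : ℝ) : gaussianReal 0 1 (Iic x) ≠ 0 := by
  intro h
  have := gaussianReal_absolutelyContinuous' 0 (one_ne_zero : (1 : ℝ≥0) ≠ 0) h
  simp at this

/-- Chebyshev bound for the upper tail of a pre-Brownian motion. -/
theorem ProbabilityTheory.IsPreBrownianReal.measure_ge_le {Ω : Type*} [MeasurableSpace Ω]
    {P : Measure Ω} [IsProbabilityMeasure P] {B : ℝ≥0 → Ω → ℝ} (hB : IsPreBrownianReal B P)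
    (t : ℝ≥0) {c : ℝ} (hc : 0 < c) : P {ω | c ≤ B t ω} ≤ ENNReal.ofReal (t / c ^ 2) := by
  have hL : MemLp (B t) 2 P :=
    (hB.isGaussianProcess.hasGaussianLaw_eval t).memLp_two
  have h := meas_ge_le_variance_div_sq hL hc
  rw [hB.integral_eval, (hB.hasLaw_eval t).variance_eq, variance_id_gaussianReal] at h
  refine (measure_mono fun ω hω => ?_).trans h
  simp only [mem_ofPred_eq, sub_zero] at hω ⊢
  exact le_trans hω (le_abs_self _)

/-- Almost every path of a pre-Brownian motion is unbounded below. -/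
theorem ProbabilityTheory.IsPreBrownianReal.ae_exists_lt {Ω : Type*} [MeasurableSpace Ω]
    {P : Measure Ω} [IsProbabilityMeasure P] {B : ℝ≥0 → Ω → ℝ} (hB : IsPreBrownianReal B P) :
    ∀ᵐ ω ∂P, ∀ c : ℝ, ∃ t, B t ω < c := by
  -- The ratios `τ (k + 1) / τ k = 4 ^ (2 * k + 1)` diverge, so each increment eventually dwarfs the
  -- value it starts from: its variance `v k` is at least `16 ^ k * τ k`.
  let τ : ℕ → ℝ≥0 := fun k => 4 ^ (k ^ 2)
  have hτ : Monotone τ := fun i j hij =>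
    pow_le_pow_right₀ (by norm_num) (Nat.pow_le_pow_left hij 2)
  have hgap : ∀ k, (τ k : ℝ) * 4 ^ k * 4 ^ k ≤ (τ (k + 1) : ℝ) - τ k := fun k => by
    have h1 : (τ (k + 1) : ℝ) = τ k * 4 ^ k * 4 ^ k * 4 := by
      simp only [τ]; push_cast; ring
    have h2 : (1 : ℝ) ≤ 4 ^ k := one_le_pow₀ (by norm_num)
    have h3 : (0 : ℝ) ≤ τ k := (τ k).2
    have h4 : (τ k : ℝ) ≤ τ k * 4 ^ k * 4 ^ k := by
      rw [mul_assoc]; exact le_mul_of_one_le_right h3 (one_le_mul_of_one_le_of_one_le h2 h2)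
    rw [h1]; linarith
  have hτ1 : ∀ k, (1 : ℝ) ≤ τ k := fun k => by
    simp only [τ]; push_cast; exact one_le_pow₀ (by norm_num)
  let v : ℕ → ℝ≥0 := fun k => nndist (τ (k + 1)).1 (τ k).1
  have hv : ∀ k, (v k : ℝ) = τ (k + 1) - τ k := fun k => by
    change dist (τ (k + 1) : ℝ) (τ k) = _
    rw [Real.dist_eq, abs_of_nonneg]
    exact sub_nonneg.2 (by exact_mod_cast hτ k.le_succ)
  have hvτ : ∀ k, (τ k : ℝ) * 4 ^ k * 4 ^ k ≤ v k := fun k => by rw [hv]; exact hgap k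
  have hv4 : ∀ k, (4 : ℝ) ^ k * 4 ^ k ≤ v k := fun k =>
    le_trans (by rw [mul_assoc]; exact le_mul_of_one_le_left (by positivity) (hτ1 k)) (hvτ k)
  have hv0 : ∀ k, 0 < (v k : ℝ) := fun k => lt_of_lt_of_le (by positivity) (hv4 k)
  have hE : ∀ᵐ ω ∂P, ∃ᶠ k in atTop, B (τ (k + 1)) ω - B (τ k) ω ∈ Iic (-√(v k : ℝ)) := by
    refine (hB.hasIndepIncrements.nat hτ).ae_frequently_mem
      (fun k => (hB.aemeasurable _).sub (hB.aemeasurable _)) (fun k => measurableSet_Iic)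
      (gaussianReal_Iic_pos (-1)) fun k => ?_
    have := (hB.hasLaw_sub (τ (k + 1)) (τ k)).map_eq
    change P.map (B (τ (k + 1)) - B (τ k)) _ = _
    rw [this]
    change gaussianReal 0 (v k) _ = _
    exact gaussianReal_Iic_neg_sqrt fun h => (hv0 k).ne' (by rw [h]; rfl)
  -- First Borel–Cantelli: Chebyshev bounds the probabilities by `4 * τ k / v k`, which is summable.
  -- Hence the starting value eventually undoes less than half of a fall of size `√(v k)`.
  have hF : ∀ᵐ ω ∂P, ∀ᶠ k in atTop, ω ∉ {ω | √(v k : ℝ) / 2 ≤ B (τ k) ω} := by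
    refine ae_eventually_notMem ?_
    have hle : ∀ k, P {ω | √(v k : ℝ) / 2 ≤ B (τ k) ω} ≤ ENNReal.ofReal (4 * (1 / 4) ^ k) := by
      intro k
      refine (hB.measure_ge_le (τ k) (half_pos (Real.sqrt_pos.2 (hv0 k)))).trans
        (ENNReal.ofReal_le_ofReal ?_)
      rw [div_pow, Real.sq_sqrt (hv0 k).le, div_le_iff₀ (by have := hv0 k; positivity)]
      have h1 : (1 : ℝ) ≤ 4 ^ k := one_le_pow₀ (by norm_num)
      have h2 : (τ k : ℝ) * 4 ^ k ≤ τ k * 4 ^ k * 4 ^ k :=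
        le_mul_of_one_le_right (by positivity) h1
      have h3 : ((1 : ℝ) / 4) ^ k * (τ k * 4 ^ k) ≤ (1 / 4) ^ k * v k :=
        mul_le_mul_of_nonneg_left (h2.trans (hvτ k)) (by positivity)
      have h4 : ((1 : ℝ) / 4) ^ k * (τ k * 4 ^ k) = τ k := by
        rw [mul_left_comm, ← mul_pow]; norm_num
      calc (τ k : ℝ) ≤ (1 / 4) ^ k * v k := h4 ▸ h3
        _ = 4 * (1 / 4) ^ k * (v k / 2 ^ 2) := by ring
    refine ne_top_of_le_ne_top ?_ (ENNReal.tsum_le_tsum hle)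
    refine Summable.tsum_ofReal_ne_top ?_
    exact (summable_geometric_of_lt_one (by norm_num) (by norm_num)).mul_left 4
  filter_upwards [hE, hF] with ω hEω hFω c
  have hlarge : ∀ᶠ k in atTop, -2 * c ≤ (4 : ℝ) ^ k :=
    (tendsto_pow_atTop_atTop_of_one_lt (by norm_num)).eventually_ge_atTop _
  obtain ⟨k, hk, hk', hk''⟩ := (hEω.and_eventually (hFω.and hlarge)).exists
  refine ⟨τ (k + 1), ?_⟩
  have hsq : (4 : ℝ) ^ k ≤ √(v k : ℝ) := Real.le_sqrt_of_sq_le (by rw [sq]; exact hv4 k)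
  simp only [mem_Iic, not_le] at hk hk'
  -- `B (τ (k + 1)) < -√(v k) + √(v k) / 2 ≤ -4 ^ k / 2 ≤ c`.
  linarith

/-! ### Late and low running minima -/

/-- A continuous function unbounded below attains arbitrarily low running minima at arbitrarily
late times. -/
theorem exists_isMinOn_Icc_le_of_unbounded {b : ℝ≥0 → ℝ} (hb : Continuous b)
    (hu : ∀ c, ∃ t, b t < c) (T : ℝ≥0) (c : ℝ) :
    ∃ t, T ≤ t ∧ b t ≤ c ∧ IsMinOn b (Icc 0 t) t := by
  obtain ⟨t₀, -, ht₀⟩ := isCompact_Icc.exists_isMinOn ⟨0, left_mem_Icc.2 (zero_le (a := T))⟩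
    hb.continuousOn
  -- Going below the minimum over `[0, T]` forces the minimiser over `[0, s]` to lie after `T`.
  obtain ⟨s, hs⟩ := hu (min c (b t₀))
  obtain ⟨t, ht, htmin⟩ := isCompact_Icc.exists_isMinOn ⟨0, left_mem_Icc.2 (zero_le (a := s))⟩
    hb.continuousOn
  have hts : b t < min c (b t₀) := (htmin ⟨zero_le, le_rfl⟩).trans_lt hs
  refine ⟨t, ?_, (hts.trans_le (min_le_left _ _)).le,
    fun r hr => htmin ⟨hr.1, hr.2.trans ht.2⟩⟩
  by_contra! h
  exact absurd (ht₀ ⟨zero_le, h.le⟩) (not_le.2 (hts.trans_le (min_le_right _ _)))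

/-! ### Simultaneous zeros of the reflecting processes -/

namespace CoupledBM

theorem skorokhodMap_eq_zero {f : ℝ≥0 → ℝ} {t : ℝ≥0} (hmin : IsMinOn f (Icc 0 t) t)
    (hneg : f t ≤ 0) : skorokhodMap f t = 0 := by
  have h : IsLeast (f '' Icc 0 t) (f t) :=
    ⟨mem_image_of_mem f ⟨zero_le, le_rfl⟩, by rintro _ ⟨s, hs, rfl⟩; exact hmin hs⟩
  rw [skorokhodMap, h.csInf_eq, min_eq_left hneg, sub_self]

/-- All reflecting processes vanish at a time at which the driving path attains a running minimum
that is low enough to absorb the initial condition. -/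
theorem rcbm_eq_zero {Ω : Type*} {σ : ℝ} (hσ : 0 < σ) {μ : ℝ≥0 → ℝ} (hμ : ∀ a, 0 < a → 0 < μ a)
    {B : ℝ≥0 → Ω → ℝ} {w : ℝ≥0 → Ω → ℝ≥0} {t : ℝ≥0} {ω : Ω} {C : ℝ} (hw0 : w 0 ω = 0)
    (hwC : ∀ a, (w a ω : ℝ) ≤ C) (hmin : IsMinOn (fun s => B s ω) (Icc 0 t) t)
    (hlow : B t ω ≤ -C / σ) (a : ℝ≥0) : rcbm σ μ B w t a ω = 0 := by
  have hBC : σ * B t ω ≤ -C := by rw [le_div_iff₀ hσ] at hlow; linarith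
  rcases eq_or_ne a 0 with rfl | ha
  · exact skorokhodMap_eq_zero (fun s _ => by simp [cbm]) (by simp [cbm, hw0])
  · have hμa := hμ a (pos_iff_ne_zero.2 ha)
    refine skorokhodMap_eq_zero (fun s hs => ?_) ?_
    · have h1 : B t ω ≤ B s ω := hmin hs
      have h2 : (s : ℝ) ≤ t := by exact_mod_cast hs.2
      have h3 : σ * B t ω ≤ σ * B s ω := mul_le_mul_of_nonneg_left h1 hσ.le
      have h4 : μ a * s ≤ μ a * t := mul_le_mul_of_nonneg_left h2 hμa.le
      simp only [cbm, if_neg ha, mem_ofPred_eq]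
      linarith
    · have h1 : 0 ≤ μ a * t := by positivity
      have h2 := hwC a
      simp only [cbm, if_neg ha]
      linarith

/-- The zero measure is finite and solves the equations, so uniqueness selects it and the default
`⊤` does not arise. -/
theorem massMeasure_zero : massMeasure (fun _ => 0) = 0 :=
  massMeasure_unique ⟨by simp, fun a _ => by simp, by simp⟩

theorem IsFiniteInitialCondition.ae_bounded {Ω : Type*} [MeasurableSpace Ω]
    {B : ℝ≥0 → Ω → ℝ} {w : ℝ≥0 → Ω → ℝ≥0} {P : Measure Ω} (hw : IsFiniteInitialCondition B w P) :
    ∀ᵐ ω ∂P, ∃ C : ℝ, ∀ a, (w a ω : ℝ) ≤ C := by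
  -- Monotone paths reduce the uncountable supremum to a countable one, which is a.e. measurable;
  -- finite mean then gives finiteness almost surely.
  have hsup : (fun ω => ⨆ a : ℝ≥0, (w a ω : ℝ≥0∞)) =ᵐ[P] fun ω => ⨆ n : ℕ, (w n ω : ℝ≥0∞) := by
    filter_upwards [hw.mono] with ω hω
    refine le_antisymm (iSup_le fun a => ?_) (iSup_le fun n => le_iSup_of_le (n : ℝ≥0) le_rfl)
    obtain ⟨n, hn⟩ := exists_nat_ge a
    exact le_iSup_of_le n (by exact_mod_cast hω hn)
  have hfin := hw.integral_at_infty
  have hmeas : AEMeasurable (fun ω => ⨆ n : ℕ, (w n ω : ℝ≥0∞)) P :=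
    AEMeasurable.iSup fun n => (hw.aemeasurable n).coe_nnreal_ennreal
  rw [lintegral_congr_ae hsup] at hfin
  filter_upwards [hsup, ae_lt_top' hmeas hfin.ne] with ω hω hlt
  rw [← hω] at hlt
  refine ⟨(⨆ a : ℝ≥0, (w a ω : ℝ≥0∞)).toReal, fun a => ?_⟩
  simpa using ENNReal.toReal_mono hlt.ne (le_iSup (fun a : ℝ≥0 => (w a ω : ℝ≥0∞)) a)

/-- Almost surely, all reflecting processes vanish simultaneously at arbitrarily late times. -/
theorem ae_exists_forall_rcbm_eq_zero {Ω : Type*} [MeasurableSpace Ω] {P : Measure Ω}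
    [IsProbabilityMeasure P]
    {B : ℝ≥0 → Ω → ℝ} (hB : IsBrownianReal B P) {σ : ℝ} (hσ : 0 < σ)
    {μ : ℝ≥0 → ℝ} (hμ : IsDriftFunction μ)
    {w : ℝ≥0 → Ω → ℝ≥0} (hw : IsFiniteInitialCondition B w P) :
    ∀ᵐ ω ∂P, ∀ T : ℝ≥0, ∃ t : ℝ≥0, T ≤ t ∧ ∀ a, rcbm σ μ B w t a ω = 0 := by
  filter_upwards [hB.cont, hB.toIsPreBrownianReal.ae_exists_lt, hw.ae_bounded, hw.zero]
    with ω hcont hunb hbdd hw0 T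
  obtain ⟨C, hC⟩ := hbdd
  obtain ⟨t, hTt, hlow, hmin⟩ := exists_isMinOn_Icc_le_of_unbounded hcont hunb T (-C / σ)
  exact ⟨t, hTt, rcbm_eq_zero hσ hμ.pos hw0 hC hmin hlow⟩

end CoupledBM

theorem proposition1 {Ω : Type*} [MeasurableSpace Ω] (P : Measure Ω) [IsProbabilityMeasure P]
    (B : ℝ≥0 → Ω → ℝ) (hB : IsBrownianReal B P) (σ : ℝ) (hσ : 0 < σ)
    (μ : ℝ≥0 → ℝ) (hμ : CoupledBM.IsDriftFunction μ)
    (w : ℝ≥0 → Ω → ℝ≥0) (hw : CoupledBM.IsFiniteInitialCondition B w P) :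
    (∀ᵐ ω ∂P, ∀ T : ℝ≥0, ∃ t : ℝ≥0, T ≤ t ∧
      IsLUB (Set.range fun a : ℝ≥0 => CoupledBM.rcbm σ μ B w t a ω) 0) ∧
    (CoupledBM.IntegrableDrift μ →
      ∀ᵐ ω ∂P, ∀ T : ℝ≥0, ∃ t : ℝ≥0, T ≤ t ∧
        CoupledBM.rcbmMeasure σ μ B w t ω = 0) := by
  have key := CoupledBM.ae_exists_forall_rcbm_eq_zero hB hσ hμ hw
  refine ⟨?_, fun _ => ?_⟩
  · filter_upwards [key] with ω hω T
    obtain ⟨t, hTt, ht⟩ := hω T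
    refine ⟨t, hTt, ?_⟩
    simp only [ht, range_const]
    exact isLUB_singleton
  · filter_upwards [key] with ω hω T
    obtain ⟨t, hTt, ht⟩ := hω T
    refine ⟨t, hTt, ?_⟩
    simp only [CoupledBM.rcbmMeasure, ht]
    exact CoupledBM.massMeasure_zero
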